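/- For a real or complex Banach space $X$ let $B_X$ be its closed unit ball. A slice of $B_X$ is a set $S(B_X,f,\varepsilon)=\{x\in B_X:\ \operatorname{Re} f(x)>\sup_{c\in B_X}|f(c)|-\varepsilon\}$ with $f\in B_{X^*}$ and $\varepsilon>0$. A convex combination of slices of $B_X$ is a set $\sum_{i=1}^n\lambda_iS_i=\{\sum_{i=1}^n\lambda_iy_i:\ y_i\in S_i\}$, where $n\ge 1$, $S_1,\dots,S_n$ are slices of $B_X$, $\lambda_i>0$ and $\sum_{i=1}^n\lambda_i=1$. The space $X$ has property (P1) (respectively, $(\overline{\mathrm{P1}})$) if for every convex combination $C$ of slices of $B_X$ and every $x\in C$ there is a relatively weakly open subset $W$ of $B_X$ with $x\in W$ and $W\subseteq C$ (respectively, $W\subseteq\overline{C}$, the norm closure of $C$). Let $\mathcal{A}$ be a complex C*-algebra, not necessarily unital, whose underlying Banach space has property (P1) or property $(\overline{\mathrm{P1}})$. Then every factor $B(H_\pi)$ appearing in the atomic decomposition of $\mathcal{A}$ is finite-dimensional; that is, for every irreducible $*$-representation $\pi$ of $\mathcal{A}$ on a complex Hilbert space $H_\pi$ (a nonzero $*$-homomorphism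 $\pi:\mathcal{A}\to B(H_\pi)$ for which $\{0\}$ and $H_\pi$ are the only closed invariant subspaces), $\dim H_\pi<\infty$, and hence $\dim B(H_\pi)<\infty$. -/

import Mathlib

section BanachSpaceNotions

variable (𝕜 : Type*) [RCLike 𝕜] {X : Type*} [NormedAddCommGroup X] [NormedSpace 𝕜 X]

/-- The slice `S(C, f, ε) = {x ∈ C : Re f(x) > sup_{c ∈ C} |f(c)| - ε}`.
It is used below only for the closed unit ball, where the supremum is over a nonempty
bounded set of real numbers. -/
def slice (C : Set X) (f : StrongDual 𝕜 X) (ε : ℝ) : Set X :=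
  {x | x ∈ C ∧ sSup ((fun c => ‖f c‖) '' C) - ε < RCLike.re (f x)}

/-- `S` is a slice of the closed unit ball `B_X`: `S = S(B_X, f, ε)` for some `f ∈ B_{X*}`
and some `ε > 0`. -/
def IsSliceOfBall (S : Set X) : Prop :=
  ∃ (f : StrongDual 𝕜 X) (ε : ℝ), ‖f‖ ≤ 1 ∧ 0 < ε ∧ S = slice 𝕜 (Metric.closedBall (0 : X) 1) f ε

/-- `C = λ₁ S₁ + ⋯ + λₙ Sₙ` for slices `S₁, …, Sₙ` of `B_X` and reals `λᵢ > 0` with sum `1`. -/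
def IsConvexCombinationOfSlices (C : Set X) : Prop :=
  ∃ (n : ℕ) (lam : Fin n → ℝ) (S : Fin n → Set X),
    (∀ i, 0 < lam i) ∧ ∑ i, lam i = 1 ∧ (∀ i, IsSliceOfBall 𝕜 (S i)) ∧
      C = {x | ∃ y : Fin n → X, (∀ i, y i ∈ S i) ∧ x = ∑ i, ((lam i : ℝ) : 𝕜) • y i}

/-- `W` is a relatively weakly open subset of `B_X`. -/
def IsRelWeaklyOpenInBall (W : Set X) : Prop :=
  ∃ U : Set (WeakSpace 𝕜 X), IsOpen U ∧
    W = {x | x ∈ Metric.closedBall (0 : X) 1 ∧ toWeakSpace 𝕜 X x ∈ U}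

variable (X)

/-- Property (P1). -/
def PropertyP1 : Prop :=
  ∀ C : Set X, IsConvexCombinationOfSlices 𝕜 C → ∀ x ∈ C,
    ∃ W : Set X, IsRelWeaklyOpenInBall 𝕜 W ∧ x ∈ W ∧ W ⊆ C

/-- Property (P1-bar); the closure is the norm closure. -/
def PropertyP1Bar : Prop :=
  ∀ C : Set X, IsConvexCombinationOfSlices 𝕜 C → ∀ x ∈ C,
    ∃ W : Set X, IsRelWeaklyOpenInBall 𝕜 W ∧ x ∈ W ∧ W ⊆ closure C

end BanachSpaceNotions

/-- A `*`-representation of a C*-algebra on a Hilbert space is irreducible if it is nonzero and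
its only closed invariant subspaces are `0` and the whole space. -/
def IsIrreducibleStarRep {A : Type*} [NonUnitalCStarAlgebra A] {H : Type*}
    [NormedAddCommGroup H] [InnerProductSpace ℂ H] [CompleteSpace H]
    (π : A →⋆ₙₐ[ℂ] (H →L[ℂ] H)) : Prop :=
  π ≠ 0 ∧ ∀ K : Submodule ℂ H, IsClosed (K : Set H) →
    (∀ a : A, ∀ v ∈ K, π a v ∈ K) → K = ⊥ ∨ K = ⊤

/-! Suppose `H` is infinite-dimensional, with an orthonormal sequence `e n` and `ξ = e 0`. Average
the slices of depth 1/8 given by the vector state at `ξ` and by its negative. Elements of the first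
slice move `ξ` by at most 1/2 and the second slice is its negative, so every `a` in the closure of
the average `C` has `‖π a ξ‖ ≤ 1/2`, while `0 ∈ C`. Take `c n` in the unit ball with `π (c n) ξ`
near `e n`. By weak compactness, any weak neighbourhood of 0 contains some `(c n - c m) / 2` with `m
< n`, which sends `ξ` to a vector of norm near `√2 / 2 > 1/2`: a contradiction.

The `c n` come from an approximate transitivity theorem with norm control. Hahn–Banach and Schur's
lemma yield `a`, of unknown norm, with `π a ξ ≈ η` and `π (star a) η ≈ ξ`. Then `b = 2a(1 + a*a)⁻¹`
is a contraction, and `π b ξ ≈ η`. -/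

/-! ### Contractions from functional calculus -/

theorem exists_norm_le_one_add_mul_star_mul {A : Type*} [NonUnitalCStarAlgebra A] (a : A) :
    ∃ b : A, ‖b‖ ≤ 1 ∧ b + a * star a * b = a + a := by
  have hnn : ∀ x ∈ quasispectrum ℝ (star a * a), 0 ≤ x := by
    let _ := CStarAlgebra.spectralOrder A
    let _ := CStarAlgebra.spectralOrderedRing A
    exact quasispectrum_nonneg_of_nonneg _ (star_mul_self_nonneg a)
  obtain ⟨p, hp⟩ : ∃ p, p = star a * a := ⟨_, rfl⟩
  have hsa : IsSelfAdjoint p := hp ▸ IsSelfAdjoint.star_mul_self a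
  rw [← hp] at hnn
  have hpos : ∀ x ∈ quasispectrum ℝ p, (1 + x) ≠ 0 := fun x hx => by
    have := hnn x hx; positivity
  obtain ⟨g, hgdef⟩ : ∃ g : ℝ → ℝ, ∀ t, g t = t / (1 + t) := ⟨_, fun _ => rfl⟩
  have hg : ContinuousOn g (quasispectrum ℝ p) := by
    rw [funext hgdef]
    exact continuousOn_id.div (by fun_prop) hpos
  have hg0 : g 0 = 0 := by simp [hgdef]
  obtain ⟨h, hh⟩ : ∃ h, h = cfcₙ g p := ⟨_, rfl⟩
  have hhsa : star h = h := hh ▸ (cfcₙ_predicate g p).star_eq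
  have key : h + p * h = p := by
    have e : cfcₙ (fun t : ℝ => t) p = p := cfcₙ_id' ℝ p
    have e1 : p * h = cfcₙ (fun t : ℝ => t * g t) p := by
      rw [cfcₙ_mul (fun t => t) g p continuousOn_id rfl hg hg0, e, hh]
    rw [e1, hh, ← cfcₙ_add (a := p) g (fun t => t * g t) hg hg0 (continuousOn_id.mul hg) (by simp)]
    conv_rhs => rw [← e]
    apply cfcₙ_congr
    intro x hx
    have := hpos x hx
    simp only [hgdef]
    field_simp
  have hnorm : ‖h - h * h‖ ≤ 1 / 4 := by
    rw [hh, ← cfcₙ_mul g g p hg hg0 hg hg0,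
      ← cfcₙ_sub (a := p) g (fun t => g t * g t) hg hg0 (hg.mul hg) (by simp [hg0])]
    refine norm_cfcₙ_le fun x hx => ?_
    have h0 := hnn x hx
    have e : g x - g x * g x = x / (1 + x) ^ 2 := by
      have := hpos x hx
      simp only [hgdef]; field_simp; ring
    rw [e, Real.norm_of_nonneg (by positivity), div_le_iff₀ (by positivity)]
    nlinarith [sq_nonneg (x - 1)]
  -- Since `1 - h` plays the role of `(1 + a*a)⁻¹`, `c` is `a(1 + a*a)⁻¹`, written without a unit.
  obtain ⟨c, hc⟩ : ∃ c, c = a - a * h := ⟨_, rfl⟩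
  have hcc : star c * c = h - h * h := by
    have e : p - p * h = h := by rw [sub_eq_iff_eq_add]; exact key.symm
    calc star c * c = (p - p * h) - h * (p - p * h) := by
          rw [hc, hp]; simp only [star_sub, star_mul, hhsa]; noncomm_ring
      _ = h - h * h := by rw [e]
  refine ⟨c + c, ?_, ?_⟩
  · have : ‖c‖ * ‖c‖ ≤ 1 / 4 := by rw [← CStarRing.norm_star_mul_self, hcc]; exact hnorm
    have : ‖c‖ ≤ 1 / 2 := by nlinarith [norm_nonneg c]
    linarith [norm_add_le c c]
  · have : c + a * star a * c = a := by
      calc c + a * star a * c = a + a * (p - (h + p * h)) := by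
            rw [hc, hp]; noncomm_ring
        _ = a := by rw [key]; simp
    rw [mul_add, add_add_add_comm, this]

/-! ### Schur's lemma and nondegeneracy -/

/-- Schur's lemma for self-adjoint operators commuting with an irreducible representation. -/
theorem IsIrreducibleStarRep.exists_eq_smul_one_of_isSelfAdjoint {A : Type*}
    [NonUnitalCStarAlgebra A] {H : Type*}
    [NormedAddCommGroup H] [InnerProductSpace ℂ H] [CompleteSpace H]
    {π : A →⋆ₙₐ[ℂ] (H →L[ℂ] H)} (hπ : IsIrreducibleStarRep π) {S : H →L[ℂ] H}
    (hS : IsSelfAdjoint S) (hcomm : ∀ a, Commute S (π a)) : ∃ r : ℝ, S = (r : ℂ) • 1 := by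
  by_cases hsub : (spectrum ℝ S).Subsingleton
  · obtain h0 | ⟨r, hr⟩ := hsub.eq_empty_or_singleton
    · refine ⟨0, ?_⟩
      rw [← cfc_id' ℝ S, cfc_congr (g := fun _ => 0) (by intro x hx; simp [h0] at hx), cfc_const_zero]
      simp
    · refine ⟨r, ?_⟩
      conv_lhs => rw [← cfc_id' ℝ S, cfc_congr (g := fun _ => r) (by intro x hx; simpa [hr] using hx),
        cfc_const r S, Algebra.algebraMap_eq_smul_one]
      ext v
      simp
  · exfalso
    rw [Set.not_subsingleton_iff] at hsub
    obtain ⟨s, hs, t, ht, hst⟩ := hsub.exists_lt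
    -- `g` and `h` have product zero and are nonzero at `t` and `s` respectively, so the kernel of
    -- `cfc g S` is a closed invariant subspace, neither zero nor everything.
    let g : ℝ → ℝ := fun x => max (x - (s + t) / 2) 0
    let h : ℝ → ℝ := fun x => max ((s + t) / 2 - x) 0
    have hg : Continuous g := by fun_prop
    have hh : Continuous h := by fun_prop
    have hgh : cfc g S * cfc h S = 0 := by
      rw [← cfc_mul g h S hg.continuousOn hh.continuousOn, ← cfc_zero ℝ S]
      congr 1
      ext x
      simp only [g, h, Pi.zero_apply, mul_eq_zero, max_eq_right_iff]
      rcases le_total x ((s + t) / 2) with hx | hx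
      · left; linarith
      · right; linarith
    have hne : ∀ (k : ℝ → ℝ) (x : ℝ), Continuous k → x ∈ spectrum ℝ S → k x ≠ 0 → cfc k S ≠ 0 := by
      intro k x hk hx hkx h0
      have h1 : k x ∈ spectrum ℝ (cfc k S) := by
        rw [cfc_map_spectrum k S hS hk.continuousOn]; exact ⟨x, hx, rfl⟩
      rw [h0] at h1
      have : Nontrivial (H →L[ℂ] H) := by
        by_contra hn
        rw [not_nontrivial_iff_subsingleton] at hn
        rw [spectrum.of_subsingleton] at hx
        exact hx
      rw [spectrum.zero_eq] at h1
      exact hkx (by simpa using h1)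
    have hcg : ∀ a, Commute (cfc g S) (π a) := fun a => (hcomm a).cfc_real g
    rcases hπ.2 (LinearMap.ker (cfc g S : H →L[ℂ] H).toLinearMap) (cfc g S).isClosed_ker
      (fun a v hv => by
        have e : (cfc g S) (π a v) = π a (cfc g S v) := congrArg (· v) (hcg a).eq
        have hv' : cfc g S v = 0 := hv
        change cfc g S (π a v) = 0
        rw [e, hv', map_zero]) with h1 | h1
    · apply hne h s hh hs (by simp only [h]; rw [max_eq_left (by linarith)]; linarith)
      ext v
      have h2 : cfc g S (cfc h S v) = 0 := congrArg (fun T : H →L[ℂ] H => T v) hgh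
      have : cfc h S v ∈ LinearMap.ker (cfc g S : H →L[ℂ] H).toLinearMap := h2
      rw [h1] at this
      simpa using this
    · apply hne g t hg ht (by simp only [g]; rw [max_eq_left (by linarith)]; linarith)
      ext v
      have : v ∈ LinearMap.ker (cfc g S : H →L[ℂ] H).toLinearMap := h1 ▸ Submodule.mem_top
      exact this

theorem IsIrreducibleStarRep.exists_eq_smul_one {A : Type*}
    [NonUnitalCStarAlgebra A] {H : Type*}
    [NormedAddCommGroup H] [InnerProductSpace ℂ H] [CompleteSpace H]
    {π : A →⋆ₙₐ[ℂ] (H →L[ℂ] H)} (hπ : IsIrreducibleStarRep π) {S : H →L[ℂ] H}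
    (hcomm : ∀ a, Commute S (π a)) : ∃ r : ℂ, S = r • 1 := by
  have hstar : ∀ a, Commute (star S) (π a) := fun a => by
    have := (hcomm (star a)).star_star
    rwa [map_star, star_star] at this
  obtain ⟨r, hr⟩ := hπ.exists_eq_smul_one_of_isSelfAdjoint (S := S + star S)
    (IsSelfAdjoint.add_star_self S) (fun a => (hcomm a).add_left (hstar a))
  obtain ⟨q, hq⟩ := hπ.exists_eq_smul_one_of_isSelfAdjoint (S := Complex.I • (S - star S))
    (by simp only [isSelfAdjoint_iff, star_smul, smul_sub, star_sub, star_star, RCLike.star_def, Complex.conj_I, neg_smul]; abel)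
    (fun a => ((hcomm a).sub_left (hstar a)).smul_left _)
  refine ⟨(r - Complex.I * q) / 2, ?_⟩
  have : (2 : ℂ) • S = ((r : ℂ) - Complex.I * q) • 1 := by
    rw [sub_smul, ← hr, mul_smul, ← hq, smul_smul, Complex.I_mul_I, two_smul]
    rw [neg_one_smul]; abel
  rw [div_eq_inv_mul, mul_smul, ← this, smul_smul]
  simp

theorem IsIrreducibleStarRep.eq_zero_of_forall_apply_eq_zero {A : Type*}
    [NonUnitalCStarAlgebra A] {H : Type*}
    [NormedAddCommGroup H] [InnerProductSpace ℂ H] [CompleteSpace H]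
    {π : A →⋆ₙₐ[ℂ] (H →L[ℂ] H)} (hπ : IsIrreducibleStarRep π) {v : H}
    (hv : ∀ a, π a v = 0) : v = 0 := by
  let N : Submodule ℂ H := ⨅ a, LinearMap.ker (π a).toLinearMap
  have hN : ∀ w, w ∈ N ↔ ∀ a, π a w = 0 := fun w => by simp [N]
  rcases hπ.2 N (by
      have : (N : Set H) = ⋂ a, {w | π a w = 0} := by ext w; simp [hN]
      rw [this]
      exact isClosed_iInter fun a => isClosed_eq (π a).continuous continuous_const)
    (fun a w hw => by rw [hN] at hw ⊢; intro b; rw [hw a, map_zero]) with h | h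
  · have := (hN v).2 hv
    rwa [h, Submodule.mem_bot] at this
  · exfalso
    apply hπ.1
    ext a w
    exact (hN w).1 (h ▸ Submodule.mem_top) a

theorem IsIrreducibleStarRep.eq_zero_of_forall_inner_eq_zero {A : Type*}
    [NonUnitalCStarAlgebra A] {H : Type*}
    [NormedAddCommGroup H] [InnerProductSpace ℂ H] [CompleteSpace H]
    {π : A →⋆ₙₐ[ℂ] (H →L[ℂ] H)} (hπ : IsIrreducibleStarRep π) {v w : H} (hv : v ≠ 0)
    (h : ∀ a, inner ℂ w (π a v) = 0) : w = 0 := by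
  let N : Submodule ℂ H := ⨅ a, LinearMap.ker (innerSL ℂ w ∘L π a).toLinearMap
  have hN : ∀ u, u ∈ N ↔ ∀ a, inner ℂ w (π a u) = 0 := fun u => by simp [N]
  rcases hπ.2 N (by
      have : (N : Set H) = ⋂ a, {u | inner ℂ w (π a u) = 0} := by ext u; simp [hN]
      rw [this]
      exact isClosed_iInter fun a => isClosed_eq (by fun_prop) continuous_const)
    (fun a u hu => by
      rw [hN] at hu ⊢; intro b
      have := hu (b * a)
      rwa [map_mul] at this) with h1 | h1
  · have := (hN v).2 h
    rw [h1, Submodule.mem_bot] at this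
    exact absurd this hv
  · apply hπ.eq_zero_of_forall_apply_eq_zero
    intro a
    have h2 := (hN w).1 (h1 ▸ Submodule.mem_top)
    have h3 := h2 (star a * a)
    rw [map_mul, map_star, mul_apply_eq_comp, ContinuousLinearMap.star_eq_adjoint,
      ContinuousLinearMap.adjoint_inner_right] at h3
    exact inner_self_eq_zero.1 h3

/-! ### Approximate transitivity -/

theorem exists_forall_eq_re_inner {H : Type*} [NormedAddCommGroup H] [InnerProductSpace ℂ H]
    [CompleteSpace H] (φ : H →L[ℝ] ℝ) : ∃ z : H, ∀ u, φ u = (inner ℂ z u).re := by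
  refine ⟨(InnerProductSpace.toDual ℂ H).symm (StrongDual.extendRCLike (𝕜 := ℂ) (F := H) φ), fun u => ?_⟩
  rw [InnerProductSpace.toDual_symm_apply]
  exact (StrongDual.re_extendRCLike_apply (𝕜 := ℂ) φ u).symm

theorem Submodule.exists_dual_eq_zero_of_notMem_closure {E : Type*} [NormedAddCommGroup E]
    [NormedSpace ℝ E] (p : Submodule ℝ E) {x : E} (hx : x ∉ closure (p : Set E)) :
    ∃ φ : E →L[ℝ] ℝ, (∀ y ∈ p, φ y = 0) ∧ φ x ≠ 0 := by
  obtain ⟨φ, u, h1, h2⟩ := geometric_hahn_banach_closed_point p.convex.closure isClosed_closure hx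
  have hu : 0 < u := by simpa using h1 0 (subset_closure p.zero_mem)
  refine ⟨φ, fun y hy => ?_, (hu.trans h2).ne'⟩
  by_contra hne
  have := h1 ((u / φ y) • y) (subset_closure (p.smul_mem _ hy))
  rw [map_smul, smul_eq_mul, div_mul_cancel₀ _ hne] at this
  exact lt_irrefl _ this

/-- The orthogonal projection onto the vectors orthogonal to the orbit of `(ξ, θ)`,
seen as an operator on `H × H`. -/
theorem IsIrreducibleStarRep.exists_projection_prod {A : Type*}
    [NonUnitalCStarAlgebra A] {H : Type*}
    [NormedAddCommGroup H] [InnerProductSpace ℂ H] [CompleteSpace H]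
    {π : A →⋆ₙₐ[ℂ] (H →L[ℂ] H)} (hπ : IsIrreducibleStarRep π) (ξ θ : H) :
    ∃ Q : H × H →L[ℂ] H × H, (∀ a u v, Q (π a u, π a v) = (π a (Q (u, v)).1, π a (Q (u, v)).2)) ∧
      Q (ξ, θ) = 0 ∧
      ∀ ζ η, (∀ a, inner ℂ ζ (π a ξ) + inner ℂ η (π a θ) = 0) → Q (ζ, η) = (ζ, η) := by
  let e := WithLp.prodContinuousLinearEquiv 2 ℂ H H
  let ρ : A → WithLp 2 (H × H) →L[ℂ] WithLp 2 (H × H) := fun a =>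
    e.symm.toContinuousLinearMap ∘L ((π a).prodMap (π a)) ∘L e.toContinuousLinearMap
  have hρ : ∀ a u v, ρ a (WithLp.toLp 2 (u, v)) = WithLp.toLp 2 (π a u, π a v) :=
    fun a u v => rfl
  have hadj : ∀ a x y, inner ℂ (ρ a x) y = inner ℂ x (ρ (star a) y) := by
    intro a x y
    change inner ℂ (WithLp.toLp 2 (π a x.ofLp.1, π a x.ofLp.2)) y
      = inner ℂ x (WithLp.toLp 2 (π (star a) y.ofLp.1, π (star a) y.ofLp.2))
    simp only [WithLp.prod_inner_apply, map_star, ContinuousLinearMap.star_eq_adjoint,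
      ContinuousLinearMap.adjoint_inner_right]
  have hmul : ∀ a b x, ρ a (ρ b x) = ρ (a * b) x := by
    intro a b x
    change WithLp.toLp 2 (π a (π b x.ofLp.1), π a (π b x.ofLp.2)) = WithLp.toLp 2 (π (a * b) x.ofLp.1, π (a * b) x.ofLp.2)
    rw [map_mul]; rfl
  let M : Submodule ℂ (WithLp 2 (H × H)) :=
    (Submodule.span ℂ (Set.range fun a => ρ a (WithLp.toLp 2 (ξ, θ))))ᗮ
  have hM : ∀ x, x ∈ M ↔ ∀ a, inner ℂ x (ρ a (WithLp.toLp 2 (ξ, θ))) = 0 := by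
    intro x
    simp only [M, Submodule.mem_orthogonal']
    constructor
    · intro h a
      exact h _ (Submodule.subset_span ⟨a, rfl⟩)
    · intro h u hu
      induction hu using Submodule.span_induction with
      | mem x hx => obtain ⟨a, rfl⟩ := hx; exact h a
      | zero => simp
      | add x y _ _ h1 h2 => rw [inner_add_right, h1, h2, add_zero]
      | smul c x _ h1 => rw [inner_smul_right, h1, mul_zero]
  have hMinv : ∀ a, ∀ x ∈ M, ρ a x ∈ M := by
    intro a x hx
    rw [hM] at hx ⊢
    intro b
    rw [hadj, hmul]; exact hx _
  have hMoinv : ∀ a, ∀ x ∈ Mᗮ, ρ a x ∈ Mᗮ := by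
    intro a x hx
    rw [Submodule.mem_orthogonal] at hx ⊢
    intro u hu
    have := hadj (star a) u x
    rw [star_star] at this
    rw [← this]; exact hx _ (hMinv _ _ hu)
  have hcomm : ∀ a x, M.starProjection (ρ a x) = ρ a (M.starProjection x) := by
    intro a x
    refine Submodule.eq_starProjection_of_mem_orthogonal
      (hMinv a _ (M.starProjection_apply_mem x)) ?_
    rw [← map_sub]
    exact hMoinv a _ (M.sub_starProjection_mem_orthogonal x)
  have horb : ∀ a, ρ a (WithLp.toLp 2 (ξ, θ)) ∈ Mᗮ := by
    intro a
    rw [Submodule.mem_orthogonal]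
    exact fun u hu => (hM u).1 hu a
  refine ⟨e.toContinuousLinearMap ∘L M.starProjection ∘L e.symm.toContinuousLinearMap, ?_, ?_, ?_⟩
  · intro a u v
    exact congrArg e (hcomm a (WithLp.toLp 2 (u, v)))
  -- Without a unit, `(ξ, θ)` need not lie in the span of its orbit; the projection kills the orbit,
  -- and nondegeneracy of `π` does the rest.
  · have h0 : ∀ a, ρ a (M.starProjection (WithLp.toLp 2 (ξ, θ))) = 0 := by
      intro a
      rw [← hcomm]
      exact M.starProjection_apply_eq_zero_iff.2 (horb a)
    ext
    · refine hπ.eq_zero_of_forall_apply_eq_zero fun a => ?_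
      exact congrArg WithLp.fst (h0 a)
    · refine hπ.eq_zero_of_forall_apply_eq_zero fun a => ?_
      exact congrArg WithLp.snd (h0 a)
  · intro ζ η h
    have : WithLp.toLp 2 (ζ, η) ∈ M := by
      rw [hM]; intro a
      rw [hρ, WithLp.prod_inner_apply]; exact h a
    exact congrArg e (Submodule.starProjection_eq_self_iff.2 this)

/-- The projection in `H × H` onto the complement of the orbit of `(ξ, θ)` commutes with the
diagonal action, so Schur makes it a 2 × 2 scalar matrix. It kills `(ξ, θ)` and fixes `(ζ, η)`; a
row with nonzero second entry gives the relation. -/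
theorem IsIrreducibleStarRep.exists_eq_smul_of_inner_add_inner_eq_zero {A : Type*}
    [NonUnitalCStarAlgebra A] {H : Type*}
    [NormedAddCommGroup H] [InnerProductSpace ℂ H] [CompleteSpace H]
    {π : A →⋆ₙₐ[ℂ] (H →L[ℂ] H)} (hπ : IsIrreducibleStarRep π) {ξ θ ζ η : H} (hξ : ξ ≠ 0)
    (hη : η ≠ 0) (h : ∀ a, inner ℂ ζ (π a ξ) + inner ℂ η (π a θ) = 0) : ∃ c : ℂ, θ = c • ξ := by
  obtain ⟨Q, hQ, hQ0, hQ1⟩ := hπ.exists_projection_prod ξ θ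
  have hQa : ∀ a x, Q (π a x.1, π a x.2) = (π a (Q x).1, π a (Q x).2) := fun a x => hQ a x.1 x.2
  let inl := ContinuousLinearMap.inl ℂ H H
  let inr := ContinuousLinearMap.inr ℂ H H
  let fst := ContinuousLinearMap.fst ℂ H H
  let snd := ContinuousLinearMap.snd ℂ H H
  have hl : ∀ a v, inl (π a v) = (π a (inl v).1, π a (inl v).2) := fun a v => by simp [inl]
  have hr : ∀ a v, inr (π a v) = (π a (inr v).1, π a (inr v).2) := fun a v => by simp [inr]
  obtain ⟨c11, h11⟩ := hπ.exists_eq_smul_one (S := fst ∘L Q ∘L inl)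
    (fun a => ContinuousLinearMap.ext fun v => by
      change (Q (inl (π a v))).1 = π a (Q (inl v)).1
      rw [hl, hQa])
  obtain ⟨c12, h12⟩ := hπ.exists_eq_smul_one (S := fst ∘L Q ∘L inr)
    (fun a => ContinuousLinearMap.ext fun v => by
      change (Q (inr (π a v))).1 = π a (Q (inr v)).1
      rw [hr, hQa])
  obtain ⟨c21, h21⟩ := hπ.exists_eq_smul_one (S := snd ∘L Q ∘L inl)
    (fun a => ContinuousLinearMap.ext fun v => by
      change (Q (inl (π a v))).2 = π a (Q (inl v)).2
      rw [hl, hQa])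
  obtain ⟨c22, h22⟩ := hπ.exists_eq_smul_one (S := snd ∘L Q ∘L inr)
    (fun a => ContinuousLinearMap.ext fun v => by
      change (Q (inr (π a v))).2 = π a (Q (inr v)).2
      rw [hr, hQa])
  have hsplit : ∀ u v, Q (u, v) = (c11 • u + c12 • v, c21 • u + c22 • v) := by
    intro u v
    have e : Q (u, v) = Q (inl u) + Q (inr v) := by rw [← map_add]; simp [inl, inr]
    have e11 := congrArg (fun T : H →L[ℂ] H => T u) h11
    have e12 := congrArg (fun T : H →L[ℂ] H => T v) h12
    have e21 := congrArg (fun T : H →L[ℂ] H => T u) h21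
    have e22 := congrArg (fun T : H →L[ℂ] H => T v) h22
    rw [e]
    exact Prod.ext (congrArg₂ (· + ·) e11 e12) (congrArg₂ (· + ·) e21 e22)
  have hz := hQ0
  have ho := hQ1 ζ η h
  rw [hsplit] at hz ho
  simp only [Prod.ext_iff, Prod.fst_zero, Prod.snd_zero] at hz ho
  obtain ⟨z1, z2⟩ := hz
  obtain ⟨o1, o2⟩ := ho
  have key : ∀ c d : ℂ, d ≠ 0 → c • ξ + d • θ = 0 → ∃ c : ℂ, θ = c • ξ := by
    intro c d hd hcd
    refine ⟨-(d⁻¹ * c), ?_⟩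
    rw [neg_smul, mul_smul, eq_neg_of_add_eq_zero_left hcd, smul_neg, neg_neg, smul_smul,
      inv_mul_cancel₀ hd, one_smul]
  by_cases hc : c12 = 0
  · have hc11 : c11 = 0 := by
      rw [hc, zero_smul, add_zero] at z1
      exact (smul_eq_zero.1 z1).resolve_right hξ
    have hζ : ζ = 0 := by rw [← o1, hc, hc11]; simp
    have hc22 : c22 ≠ 0 := by
      rintro rfl
      apply hη
      rw [← o2, hζ]; simp
    exact key _ _ hc22 z2
  · exact key _ _ hc z1

/-- The pairs `(π a ξ, π (star a) η)` form only a real subspace, so Hahn–Banach is applied over the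
reals. An annihilating pair `(ζ, θ)` must satisfy `θ = c • ξ` and `ζ = -conj c • η`, and then it
also kills `(η, ξ)`. -/
theorem IsIrreducibleStarRep.exists_norm_sub_lt {A : Type*}
    [NonUnitalCStarAlgebra A] {H : Type*}
    [NormedAddCommGroup H] [InnerProductSpace ℂ H] [CompleteSpace H]
    {π : A →⋆ₙₐ[ℂ] (H →L[ℂ] H)} (hπ : IsIrreducibleStarRep π) {ξ η : H} (hξ : ‖ξ‖ = 1)
    (hη : ‖η‖ = 1) {δ : ℝ} (hδ : 0 < δ) :
    ∃ a, ‖π a ξ - η‖ < δ ∧ ‖π (star a) η - ξ‖ < δ := by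
  let L : A →ₗ[ℝ] H × H :=
    { toFun := fun a => (π a ξ, π (star a) η)
      map_add' := fun a b => by simp
      map_smul' := fun r a => by
        have e : r • a = (r : ℂ) • a := (Complex.coe_smul r a).symm
        rw [e, star_smul, map_smul, map_smul]
        simp }
  have hmem : (η, ξ) ∈ closure ((LinearMap.range L : Submodule ℝ (H × H)) : Set (H × H)) := by
    by_contra hn
    obtain ⟨φ, h0, hne⟩ := Submodule.exists_dual_eq_zero_of_notMem_closure _ hn
    obtain ⟨ζ, hζ⟩ := exists_forall_eq_re_inner (φ ∘L ContinuousLinearMap.inl ℝ H H)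
    obtain ⟨θ, hθ⟩ := exists_forall_eq_re_inner (φ ∘L ContinuousLinearMap.inr ℝ H H)
    have hφ : ∀ u v, φ (u, v) = (inner ℂ ζ u).re + (inner ℂ θ v).re := by
      intro u v
      rw [← hζ, ← hθ]
      simp [← map_add]
    have hre : ∀ a, (inner ℂ ζ (π a ξ) + inner ℂ η (π a θ)).re = 0 := by
      intro a
      have h1 := h0 (L a) ⟨a, rfl⟩
      change φ (π a ξ, π (star a) η) = 0 at h1
      rw [hφ, map_star, ContinuousLinearMap.star_eq_adjoint,
        ContinuousLinearMap.adjoint_inner_right, ← inner_conj_symm (π a θ), Complex.conj_re] at h1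
      rwa [Complex.add_re]
    have hann : ∀ a, inner ℂ ζ (π a ξ) + inner ℂ η (π a θ) = 0 := by
      intro a
      refine Complex.ext (hre a) ?_
      have := hre (Complex.I • a)
      rw [map_smul, smul_apply, smul_apply,
        inner_smul_right, inner_smul_right, ← mul_add, Complex.I_mul_re] at this
      exact neg_eq_zero.1 this
    have hξ0 : ξ ≠ 0 := by rintro rfl; simp at hξ
    have hη0 : η ≠ 0 := by rintro rfl; simp at hη
    obtain ⟨c, rfl⟩ := hπ.exists_eq_smul_of_inner_add_inner_eq_zero hξ0 hη0 hann
    have hz : ζ + (starRingEnd ℂ c) • η = 0 := by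
      refine hπ.eq_zero_of_forall_inner_eq_zero hξ0 fun a => ?_
      rw [← hann a, inner_add_left, inner_smul_left, map_smul, inner_smul_right]
      simp
    apply hne
    rw [hφ, eq_neg_of_add_eq_zero_left hz, inner_neg_left, inner_smul_left, inner_smul_left,
      inner_self_eq_norm_sq_to_K, inner_self_eq_norm_sq_to_K, hξ, hη]
    simp
  obtain ⟨_, ⟨a, rfl⟩, ha⟩ := Metric.mem_closure_iff.1 hmem δ hδ
  refine ⟨a, ?_⟩
  rw [dist_comm, dist_eq_norm] at ha
  exact ⟨(norm_fst_le _).trans_lt ha, (norm_snd_le _).trans_lt ha⟩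

/-- Elements of the unit ball act transitively, up to approximation, on unit vectors. -/
theorem IsIrreducibleStarRep.exists_norm_le_one_norm_sub_lt {A : Type*}
    [NonUnitalCStarAlgebra A] {H : Type*}
    [NormedAddCommGroup H] [InnerProductSpace ℂ H] [CompleteSpace H]
    {π : A →⋆ₙₐ[ℂ] (H →L[ℂ] H)} (hπ : IsIrreducibleStarRep π) {ξ η : H} (hξ : ‖ξ‖ = 1)
    (hη : ‖η‖ = 1) {δ : ℝ} (hδ : 0 < δ) :
    ∃ b, ‖b‖ ≤ 1 ∧ ‖π b ξ - η‖ < δ := by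
  obtain ⟨a, h1, h2⟩ := hπ.exists_norm_sub_lt hξ hη (half_pos hδ)
  obtain ⟨b, hb, hab⟩ := exists_norm_le_one_add_mul_star_mul a
  refine ⟨b, hb, ?_⟩
  obtain ⟨α, hα⟩ : ∃ α, α = π a ξ - η := ⟨_, rfl⟩
  obtain ⟨β, hβ⟩ : ∃ β, β = π (star a) η - ξ := ⟨_, rfl⟩
  obtain ⟨w, hw⟩ : ∃ w, w = π b ξ - η := ⟨_, rfl⟩
  rw [← hα] at h1; rw [← hβ] at h2; rw [← hw]
  have hop : π b ξ + π a (π (star a) (π b ξ)) = π a ξ + π a ξ := by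
    have := congrArg (fun x => π x ξ) hab
    simpa only [map_add, map_mul, add_apply,
      mul_apply_eq_comp] using this
  -- Pairing this with `w` moves `a` to the other side as `star a`, so no bound on `‖a‖` is needed.
  have heq : w + π a (π (star a) w) = α - π a β := by
    have e : π b ξ = π a ξ + π a ξ - π a (π (star a) (π b ξ)) := eq_sub_of_add_eq hop
    rw [hw, hα, hβ]
    simp only [map_sub]
    nth_rewrite 1 [e]
    abel
  have hadj : ∀ x y, inner ℂ x (π a y) = inner ℂ (π (star a) x) y := by
    intro x y
    rw [map_star, ContinuousLinearMap.star_eq_adjoint, ContinuousLinearMap.adjoint_inner_left]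
  have hin := congrArg (fun x => (inner ℂ w x).re) heq
  simp only [inner_add_right, inner_sub_right, hadj, Complex.add_re, Complex.sub_re] at hin
  have s1 : (inner ℂ w w).re = ‖w‖ ^ 2 := inner_self_eq_norm_sq (𝕜 := ℂ) w
  have s2 : (inner ℂ (π (star a) w) (π (star a) w)).re = ‖π (star a) w‖ ^ 2 :=
    inner_self_eq_norm_sq (𝕜 := ℂ) _
  have s3 : (inner ℂ w α).re ≤ ‖w‖ * ‖α‖ := re_inner_le_norm (𝕜 := ℂ) w α
  have s4 : -(inner ℂ (π (star a) w) β).re ≤ ‖π (star a) w‖ * ‖β‖ := by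
    have := re_inner_le_norm (𝕜 := ℂ) (π (star a) w) (-β)
    rwa [inner_neg_right, norm_neg, map_neg] at this
  have hsq : ‖w‖ ^ 2 ≤ ‖α‖ ^ 2 + ‖β‖ ^ 2 := by
    nlinarith [sq_nonneg (‖w‖ - ‖α‖), sq_nonneg (‖π (star a) w‖ - ‖β‖)]
  have hα0 := norm_nonneg α
  have hβ0 := norm_nonneg β
  refine lt_of_pow_lt_pow_left₀ 2 hδ.le (hsq.trans_lt ?_)
  nlinarith

/-! ### Weak neighbourhoods and orthonormal sequences -/

open Topology in
/-- Every weak neighbourhood of zero contains half the difference of two terms of any given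
sequence in the unit ball. -/
theorem exists_lt_half_sub_mem_of_mem_nhds_zero {X : Type*} [NormedAddCommGroup X]
    [NormedSpace ℂ X] {U : Set (WeakSpace ℂ X)} (hU : U ∈ 𝓝 0) {c : ℕ → X}
    (hc : ∀ n, ‖c n‖ ≤ 1) :
    ∃ m n, m < n ∧ toWeakSpace ℂ X ((1 / 2 : ℂ) • (c n - c m)) ∈ U := by
  let F : X → (StrongDual ℂ X → ℂ) := fun x f => f x
  have hF : ∃ V ∈ 𝓝 (0 : StrongDual ℂ X → ℂ), ∀ x, F x ∈ V → toWeakSpace ℂ X x ∈ U := by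
    obtain ⟨V, hV, hVU⟩ := (mem_nhds_induced _ _ _).1 hU
    refine ⟨V, ?_, fun x hx => hVU hx⟩
    convert hV using 2
    ext f
    exact (map_zero f).symm
  obtain ⟨V, hV, hVU⟩ := hF
  have hK : IsCompact (Set.univ.pi fun f : StrongDual ℂ X => Metric.closedBall (0 : ℂ) ‖f‖) :=
    isCompact_univ_pi fun f => isCompact_closedBall _ _
  have hmem : ∀ n, F (c n) ∈ Set.univ.pi fun f : StrongDual ℂ X => Metric.closedBall (0 : ℂ) ‖f‖ := by
    intro n f _
    rw [mem_closedBall_zero_iff]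
    exact (f.le_opNorm_of_le (hc n)).trans (by simp)
  -- A cluster point in the product of discs: two terms close to `z` have a small difference.
  obtain ⟨z, -, hz⟩ := hK.exists_mapClusterPt (f := Filter.atTop) (u := fun n => F (c n))
    (Filter.tendsto_principal.2 (Filter.Eventually.of_forall hmem))
  have hG : Continuous fun p : (StrongDual ℂ X → ℂ) × (StrongDual ℂ X → ℂ) =>
      (1 / 2 : ℂ) • (p.1 - p.2) := by fun_prop
  have hV' := hG.continuousAt.preimage_mem_nhds (x := (z, z)) (t := V) (by simpa using hV)
  rw [nhds_prod_eq, Filter.mem_prod_same_iff] at hV'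
  obtain ⟨N, hN, hNV⟩ := hV'
  have hfr := mapClusterPt_iff_frequently.1 hz N hN
  obtain ⟨m, -, hm⟩ := Filter.frequently_atTop.1 hfr 0
  obtain ⟨n, hn, hn'⟩ := Filter.frequently_atTop.1 hfr (m + 1)
  refine ⟨m, n, hn, hVU _ ?_⟩
  have : (F (c n), F (c m)) ∈ N ×ˢ N := ⟨hn', hm⟩
  have h2 : (1 / 2 : ℂ) • (F (c n) - F (c m)) ∈ V := hNV this
  convert h2 using 1
  ext f
  simp [F]

theorem exists_nat_orthonormal {H : Type*} [NormedAddCommGroup H] [InnerProductSpace ℂ H]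
    [CompleteSpace H] (h : ¬ FiniteDimensional ℂ H) : ∃ e : ℕ → H, Orthonormal ℂ e := by
  obtain ⟨w, b, hb⟩ := exists_hilbertBasis ℂ H
  have : Infinite w := by
    by_contra hfin
    rw [not_infinite_iff_finite] at hfin
    apply h
    have hfd : FiniteDimensional ℂ (Submodule.span ℂ (Set.range b)) :=
      FiniteDimensional.span_of_finite ℂ (Set.finite_range b)
    have ht := b.dense_span
    rw [(Submodule.closed_of_finiteDimensional _).submodule_topologicalClosure_eq] at ht
    rw [ht] at hfd
    exact Module.finite_def.2 ((Submodule.fg_top ⊤).1 (Module.finite_def.1 hfd))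
  exact ⟨_, b.orthonormal.comp _ (Infinite.natEmbedding w).injective⟩

theorem PropertyP1.propertyP1Bar {𝕜 X : Type*} [RCLike 𝕜] [NormedAddCommGroup X]
    [NormedSpace 𝕜 X] (h : PropertyP1 𝕜 X) : PropertyP1Bar 𝕜 X := fun C hC x hx => by
  obtain ⟨W, hW, hxW, hWC⟩ := h C hC x hx
  exact ⟨W, hW, hxW, hWC.trans subset_closure⟩

/-! ### Vector functionals and their slices -/

/-- The vector functional `a ↦ ⟪ξ, π a ξ⟫`. -/
noncomputable def vectorFunctional {A : Type*} [NonUnitalCStarAlgebra A] {H : Type*}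
    [NormedAddCommGroup H] [InnerProductSpace ℂ H] [CompleteSpace H]
    (π : A →⋆ₙₐ[ℂ] (H →L[ℂ] H)) (ξ : H) : StrongDual ℂ A :=
  LinearMap.mkContinuous
    { toFun := fun a => inner ℂ ξ (π a ξ)
      map_add' := fun a b => by simp
      map_smul' := fun c a => by simp } (‖ξ‖ * ‖ξ‖) fun a => by
    refine (norm_inner_le_norm ξ (π a ξ)).trans ?_
    have h1 := (π a).le_of_opNorm_le (NonUnitalStarAlgHom.norm_apply_le π a) ξ
    calc ‖ξ‖ * ‖π a ξ‖ ≤ ‖ξ‖ * (‖a‖ * ‖ξ‖) := by gcongr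
      _ = ‖ξ‖ * ‖ξ‖ * ‖a‖ := by ring

theorem vectorFunctional_apply {A : Type*} [NonUnitalCStarAlgebra A] {H : Type*}
    [NormedAddCommGroup H] [InnerProductSpace ℂ H] [CompleteSpace H]
    (π : A →⋆ₙₐ[ℂ] (H →L[ℂ] H)) (ξ : H) (a : A) :
    vectorFunctional π ξ a = inner ℂ ξ (π a ξ) := rfl

theorem norm_vectorFunctional_le {A : Type*} [NonUnitalCStarAlgebra A] {H : Type*}
    [NormedAddCommGroup H] [InnerProductSpace ℂ H] [CompleteSpace H]
    (π : A →⋆ₙₐ[ℂ] (H →L[ℂ] H)) {ξ : H} (hξ : ‖ξ‖ = 1) : ‖vectorFunctional π ξ‖ ≤ 1 :=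
  (LinearMap.mkContinuous_norm_le _ (by positivity) _).trans (by simp [hξ])

theorem IsIrreducibleStarRep.exists_re_vectorFunctional_gt {A : Type*}
    [NonUnitalCStarAlgebra A] {H : Type*}
    [NormedAddCommGroup H] [InnerProductSpace ℂ H] [CompleteSpace H]
    {π : A →⋆ₙₐ[ℂ] (H →L[ℂ] H)} (hπ : IsIrreducibleStarRep π) {ξ : H} (hξ : ‖ξ‖ = 1)
    {δ : ℝ} (hδ : 0 < δ) :
    ∃ b, ‖b‖ ≤ 1 ∧ 1 - δ < (vectorFunctional π ξ b).re := by
  obtain ⟨b, hb, hbδ⟩ := hπ.exists_norm_le_one_norm_sub_lt hξ hξ hδ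
  refine ⟨b, hb, ?_⟩
  have h1 := re_inner_le_norm (𝕜 := ℂ) ξ (ξ - π b ξ)
  have h2 : (inner ℂ ξ ξ).re = ‖ξ‖ ^ 2 := inner_self_eq_norm_sq (𝕜 := ℂ) ξ
  rw [inner_sub_right, map_sub, hξ, one_mul, norm_sub_rev] at h1
  rw [vectorFunctional_apply]
  simp only [RCLike.re_to_complex] at h1
  rw [h2, hξ] at h1
  linarith

theorem IsIrreducibleStarRep.sSup_norm_vectorFunctional {A : Type*}
    [NonUnitalCStarAlgebra A] {H : Type*}
    [NormedAddCommGroup H] [InnerProductSpace ℂ H] [CompleteSpace H]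
    {π : A →⋆ₙₐ[ℂ] (H →L[ℂ] H)} (hπ : IsIrreducibleStarRep π) {ξ : H} (hξ : ‖ξ‖ = 1) :
    sSup ((fun c => ‖vectorFunctional π ξ c‖) '' Metric.closedBall (0 : A) 1) = 1 := by
  refine csSup_eq_of_forall_le_of_forall_lt_exists_gt ⟨_, ⟨0, by simp, rfl⟩⟩ ?_ ?_
  · rintro _ ⟨c, hc, rfl⟩
    rw [mem_closedBall_zero_iff] at hc
    exact ((vectorFunctional π ξ).le_of_opNorm_le_of_le (norm_vectorFunctional_le π hξ) hc).trans
      (by simp)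
  · intro r hr
    obtain ⟨b, hb, hbr⟩ := hπ.exists_re_vectorFunctional_gt hξ (sub_pos.2 hr)
    exact ⟨_, ⟨b, by simpa using hb, rfl⟩,
      lt_of_lt_of_le (by linarith) (Complex.re_le_norm _)⟩

theorem norm_apply_sub_le_half {A : Type*} [NonUnitalCStarAlgebra A] {H : Type*}
    [NormedAddCommGroup H] [InnerProductSpace ℂ H] [CompleteSpace H]
    (π : A →⋆ₙₐ[ℂ] (H →L[ℂ] H)) {ξ : H} (hξ : ‖ξ‖ = 1) {a : A} (ha : ‖a‖ ≤ 1)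
    (h : 7 / 8 < (vectorFunctional π ξ a).re) : ‖π a ξ - ξ‖ ≤ 1 / 2 := by
  rw [vectorFunctional_apply] at h
  have h1 := norm_sub_sq (𝕜 := ℂ) (π a ξ) ξ
  rw [inner_re_symm, hξ] at h1
  simp only [RCLike.re_to_complex] at h1
  have h2 : ‖π a ξ‖ ≤ 1 := by
    have := (π a).le_of_opNorm_le ((NonUnitalStarAlgHom.norm_apply_le π a).trans ha) ξ
    simpa [hξ] using this
  have h3 := norm_nonneg (π a ξ)
  refine le_of_sq_le_sq ?_ (by norm_num)
  -- `‖π a ξ - ξ‖² ≤ 1 - 2 · 7/8 + 1 = 1/4`.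
  nlinarith

/-! ### The contradiction in infinite dimension -/

theorem mainTheorem7 {A : Type*} [NonUnitalCStarAlgebra A]
    (hA : PropertyP1 ℂ A ∨ PropertyP1Bar ℂ A)
    {H : Type*} [NormedAddCommGroup H] [InnerProductSpace ℂ H] [CompleteSpace H]
    (π : A →⋆ₙₐ[ℂ] (H →L[ℂ] H)) (hπ : IsIrreducibleStarRep π) :
    FiniteDimensional ℂ H ∧ FiniteDimensional ℂ (H →L[ℂ] H) := by
  suffices hfin : FiniteDimensional ℂ H from ⟨hfin, inferInstance⟩
  by_contra hinf
  have hA' : PropertyP1Bar ℂ A := hA.elim PropertyP1.propertyP1Bar id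
  obtain ⟨e, he⟩ := exists_nat_orthonormal hinf
  obtain ⟨ξ, hξ⟩ : ∃ ξ, ξ = e 0 := ⟨_, rfl⟩
  have hξ1 : ‖ξ‖ = 1 := hξ ▸ he.1 0
  obtain ⟨f, hf⟩ : ∃ f, f = vectorFunctional π ξ := ⟨_, rfl⟩
  have hsup : sSup ((fun c => ‖f c‖) '' Metric.closedBall (0 : A) 1) = 1 :=
    hf ▸ hπ.sSup_norm_vectorFunctional hξ1
  have hfn : ‖f‖ ≤ 1 := hf ▸ norm_vectorFunctional_le π hξ1
  let S : Fin 2 → Set A := ![slice ℂ (Metric.closedBall (0 : A) 1) f (1 / 8),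
    slice ℂ (Metric.closedBall (0 : A) 1) (-f) (1 / 8)]
  have hS0 : ∀ x, x ∈ S 0 ↔ ‖x‖ ≤ 1 ∧ 7 / 8 < (f x).re := by
    intro x
    change x ∈ Metric.closedBall 0 1 ∧ sSup _ - 1 / 8 < (f x).re ↔ _
    rw [hsup, mem_closedBall_zero_iff]
    norm_num
  have hS1 : ∀ x, x ∈ S 1 ↔ ‖-x‖ ≤ 1 ∧ 7 / 8 < (f (-x)).re := by
    intro x
    change x ∈ Metric.closedBall 0 1 ∧
      sSup ((fun c => ‖(-f) c‖) '' Metric.closedBall (0 : A) 1) - 1 / 8 < ((-f) x).re ↔ _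
    simp only [neg_apply, norm_neg, map_neg]
    rw [hsup, mem_closedBall_zero_iff]
    norm_num
  let C : Set A := {x | ∃ y : Fin 2 → A, (∀ i, y i ∈ S i) ∧
    x = ∑ i, (((fun _ => 1 / 2 : Fin 2 → ℝ) i : ℝ) : ℂ) • y i}
  have hC : IsConvexCombinationOfSlices ℂ C := by
    refine ⟨2, fun _ => 1 / 2, S, fun _ => by norm_num, by norm_num, fun i => ?_, rfl⟩
    fin_cases i
    · exact ⟨f, 1 / 8, hfn, by norm_num, rfl⟩
    · exact ⟨-f, 1 / 8, by rwa [norm_neg], by norm_num, rfl⟩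
  have h0C : (0 : A) ∈ C := by
    obtain ⟨b, hb, hb'⟩ := hπ.exists_re_vectorFunctional_gt hξ1 (δ := 1 / 8) (by norm_num)
    rw [← hf] at hb'
    refine ⟨![b, -b], fun i => ?_, by simp [Fin.sum_univ_two]⟩
    fin_cases i
    · exact (hS0 b).2 ⟨hb, by linarith⟩
    · exact (hS1 (-b)).2 (by rw [neg_neg]; exact ⟨hb, by linarith⟩)
  have hcont : Continuous fun a => π a ξ := by
    have : Continuous π := AddMonoidHomClass.continuous_of_bound π 1 fun a => by
      rw [one_mul]; exact NonUnitalStarAlgHom.norm_apply_le π a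
    fun_prop
  have hCle : closure C ⊆ {a | ‖π a ξ‖ ≤ 1 / 2} := by
    refine closure_minimal ?_ (isClosed_le hcont.norm continuous_const)
    rintro _ ⟨y, hy, rfl⟩
    have h0 := (hS0 _).1 (hy 0)
    have h1 := (hS1 _).1 (hy 1)
    rw [hf] at h0 h1
    have n0 := norm_apply_sub_le_half π hξ1 h0.1 h0.2
    have n1 := norm_apply_sub_le_half π hξ1 h1.1 h1.2
    -- The two copies of `ξ` cancel because the weights are equal.
    have e : π (∑ i, (((fun _ => 1 / 2 : Fin 2 → ℝ) i : ℝ) : ℂ) • y i) ξ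
        = (1 / 2 : ℂ) • ((π (y 0) ξ - ξ) - (π (-(y 1)) ξ - ξ)) := by
      simp [Fin.sum_univ_two, map_smul]
    change ‖_‖ ≤ _
    rw [e, norm_smul]
    have := norm_sub_le (π (y 0) ξ - ξ) (π (-(y 1)) ξ - ξ)
    have e2 : ‖(1 / 2 : ℂ)‖ = 1 / 2 := by norm_num
    rw [e2]
    linarith
  obtain ⟨W, ⟨U, hU, rfl⟩, h0W, hWC⟩ := hA' C hC 0 h0C
  -- With error 1/10 the final comparison is `1 + 2/10 = 6/5 < √2`.
  choose c hc hce using fun n => hπ.exists_norm_le_one_norm_sub_lt hξ1 (he.1 n)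
    (δ := 1 / 10) (by norm_num)
  have h0U : U ∈ nhds (0 : WeakSpace ℂ A) := hU.mem_nhds (by simpa using h0W.2)
  obtain ⟨m, n, hmn, hU'⟩ := exists_lt_half_sub_mem_of_mem_nhds_zero h0U hc
  have hle := hCle (hWC ⟨by
    rw [mem_closedBall_zero_iff, norm_smul]
    have := norm_sub_le (c n) (c m)
    have := hc n
    have := hc m
    norm_num
    linarith, hU'⟩)
  change ‖π ((1 / 2 : ℂ) • (c n - c m)) ξ‖ ≤ 1 / 2 at hle
  have hle' : ‖π (c n) ξ - π (c m) ξ‖ ≤ 1 := by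
    rw [map_smul, smul_apply, norm_smul, map_sub, sub_apply] at hle
    norm_num at hle
    linarith
  have horth : ‖e n - e m‖ ^ 2 = 2 := by
    rw [norm_sub_sq (𝕜 := ℂ), he.1, he.1, he.2 hmn.ne']
    norm_num
  have htri : ‖e n - e m‖ ≤ 6 / 5 := by
    have h1 : e n - e m = (π (c n) ξ - π (c m) ξ) - (π (c n) ξ - e n) + (π (c m) ξ - e m) := by
      abel
    rw [h1]
    have h2 := norm_add_le ((π (c n) ξ - π (c m) ξ) - (π (c n) ξ - e n)) (π (c m) ξ - e m)
    have h3 := norm_sub_le (π (c n) ξ - π (c m) ξ) (π (c n) ξ - e n)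
    linarith [(hce n).le, (hce m).le]
  nlinarith [norm_nonneg (e n - e m)]
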